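/- Let $(Z,\mathfrak Z)$ be a measurable space, $\nu$ a $\sigma$-finite measure on it, and $\eta$ a Poisson point process on $Z$ with intensity $\nu$, defined on a probability space $(\Omega,\mathfrak O,\mathbb P)$, that is almost surely proper, i.e. almost surely $\eta=\sum_{i\in I}\delta_{x_i}$ with $I$ countable. All random variables are real and measurable with respect to $\eta$; write $F=f(\eta)$ with $f$ a measurable function on the space of countable sums of $\mathbb N$-valued measures (endowed with the $\sigma$-algebra generated by the evaluations $m\mapsto m(B)$, $B\in\mathfrak Z$), and $\mathcal L^p(\mathbb P)=\mathcal L^p(\Omega,\sigma(\eta),\mathbb P)$. For $z\in Z$ let $$D_z^+F=f(\eta+\delta_z)-f(\eta),\qquad D_z^-F=\bigl(f(\eta)-f(\eta-\delta_z)\bigr)1_{z\in\eta}.$$ Let $\operatorname{dom}D$ be the set of $F\in\mathcal L^2(\mathbb P)$ with $\mathbb E\int (D_z^+F)^2\,\nu(\mathrm dz)<\infty$, endowed with the norm $\bigl(\mathbb E F^2+\mathbb E\int (D_z^+F)^2\,\nu(\mathrm dz)\bigr)^{1/2}$. Let $$\mathcal E(F,G)=\mathbb E\int D_z^+F\,D_z^+G\,\nu(\mathrm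 dz),\qquad F,G\in\operatorname{dom}D$$ (the Dirichlet form of the Poisson Ornstein--Uhlenbeck generator), and let $\mathcal A=\operatorname{dom}D\cap\mathcal L^\infty(\mathbb P)$. For $F,\Phi\in\mathcal A$ put $$\mathbf\Gamma(F)[\Phi]=\mathcal E(F,F\Phi)-\tfrac12\mathcal E(F^2,\Phi),$$ and, for $\Phi\in\mathcal A$, extend $F\mapsto\mathbf\Gamma(F)[\Phi]$ by continuity from the dense subspace $\mathcal A$ to $\operatorname{dom}D$. Let $\operatorname{dom}\Gamma$ be the set of $F\in\operatorname{dom}D$ for which there is a non-negative $\Gamma(F)\in\mathcal L^1(\mathbb P)$ such that $\mathbf\Gamma(F)[\Phi]=\mathbb E\,\Gamma(F)\Phi$ for all $\Phi\in\mathcal A$; $\Gamma(F)$ is the carré du champ of $F$. Then $\operatorname{dom}\Gamma=\operatorname{dom}D$ and, for every $F\in\operatorname{dom}D$, the density $\Gamma(F)$ is almost surely unique and $$\Gamma(F)=\frac12\int (D_z^+F)^2\,\nu(\mathrm dz)+\frac12\int (D_z^-F)^2\,\eta(\mathrm dz)\qquad\text{almost surely,}$$ where, for $\eta=\sum_{i\in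 I}\delta_{x_i}$, the last integral is $\sum_{i\in I}\bigl(f(\eta)-f(\eta-\delta_{x_i})\bigr)^2$. -/

import Mathlib

open MeasureTheory ProbabilityTheory Filter Topology
open scoped ENNReal

namespace PoissonSpace

variable {Z Ω : Type*} [MeasurableSpace Z] [MeasurableSpace Ω]

/-- Countable sums of `ℕ`-valued measures on `Z`. The ambient σ-algebra on `Measure Z` is the one
generated by the evaluations `m ↦ m B`, `B` measurable. -/
def pointMeasures (Z : Type*) [MeasurableSpace Z] : Set (Measure Z) :=
  {m | ∃ k : ℕ → Measure Z,
    (∀ n B, MeasurableSet B → ∃ j : ℕ, k n B = (j : ℝ≥0∞)) ∧ m = Measure.sum k}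

/-- A measure is proper if it is a countable sum of Dirac masses. -/
def IsProper (m : Measure Z) : Prop :=
  ∃ (I : Set ℕ) (x : I → Z), m = Measure.sum fun i => Measure.dirac (x i)

/-- `η` is a Poisson point process with intensity `ν` on the probability space `(Ω, P)`. -/
structure IsPoissonProcess (η : Ω → Measure Z) (ν : Measure Z) (P : Measure Ω) : Prop where
  measurable : Measurable η
  mem_pointMeasures : ∀ ω, η ω ∈ pointMeasures Z
  indep : ∀ (n : ℕ) (B : Fin n → Set Z), (∀ i, MeasurableSet (B i)) →
    Pairwise (fun i j => Disjoint (B i) (B j)) → iIndepFun (fun i ω => η ω (B i)) P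
  law : ∀ B : Set Z, MeasurableSet B → ν B < ∞ →
    P.map (fun ω => η ω B) = (poissonMeasure (ν B).toNNReal).map (fun k : ℕ => (k : ℝ≥0∞))

/-! A random variable `F` measurable with respect to `η` is written `F = f(η)`, where the
representative `f` is a measurable function of the point measure. Real measurable functions on the
subspace of point measures are exactly the restrictions of measurable `f : Measure Z → ℝ`. All
notions below are expressed through representatives. -/

/-- Add operator: `D⁺_z F = f(η + δ_z) - f(η)`. -/
noncomputable def addOp (f : Measure Z → ℝ) (m : Measure Z) (z : Z) : ℝ :=
  f (m + Measure.dirac z) - f m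

/-- Drop operator: `D⁻_z F = (f(η) - f(η - δ_z)) 1_{z ∈ η}`; `z ∈ η` means `δ_z ≤ η`. -/
noncomputable def dropOp (f : Measure Z → ℝ) (m : Measure Z) : Z → ℝ :=
  Set.indicator {z | Measure.dirac z ≤ m} fun z => f m - f (m - Measure.dirac z)

/-- Integral of a non-negative function. It is the Lebesgue integral if `u` is measurable
(`upperIntegral_eq_lintegral`). On a general measurable space `{z | z ∈ m}` may fail to be measurable,
even if `m` is proper; then this (upper) integral of `(D⁻F)²` is the sum over the points of `m`
(`upperIntegral_dropOp_sq`). -/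
noncomputable def upperIntegral (m : Measure Z) (u : Z → ℝ≥0∞) : ℝ≥0∞ :=
  ⨅ (g : Z → ℝ≥0∞) (_ : Measurable g) (_ : u ≤ g), ∫⁻ z, g z ∂m

theorem upperIntegral_eq_lintegral (m : Measure Z) {u : Z → ℝ≥0∞} (hu : Measurable u) :
    upperIntegral m u = ∫⁻ z, u z ∂m := by
  refine le_antisymm (iInf₂_le_of_le u hu (iInf_le _ le_rfl)) ?_
  exact le_iInf₂ fun g _ => le_iInf fun h => lintegral_mono h

theorem dirac_eq_of_forall {x y : Z}
    (h : ∀ B : Set Z, MeasurableSet B → x ∈ B → y ∈ B) :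
    Measure.dirac y = Measure.dirac x := by
  refine Measure.ext fun B hB => ?_
  rw [Measure.dirac_apply' _ hB, Measure.dirac_apply' _ hB]
  by_cases hx : x ∈ B
  · simp [hx, h B hB hx]
  · have : y ∉ B := h Bᶜ hB.compl hx
    simp [hx, this]

theorem upperIntegral_dropOp_sq (f : Measure Z → ℝ) {I : Set ℕ} (x : I → Z) (m : Measure Z)
    (hm : m = Measure.sum fun i => Measure.dirac (x i)) :
    upperIntegral m (fun z => ENNReal.ofReal (dropOp f m z ^ 2)) =
      ∑' i, ENNReal.ofReal ((f m - f (m - Measure.dirac (x i))) ^ 2) := by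
  classical
  have hmem : ∀ i, Measure.dirac (x i) ≤ m := fun i => by
    rw [hm]; exact Measure.le_sum _ i
  set v : Measure Z → ℝ≥0∞ := fun d => ENNReal.ofReal ((f m - f (m - d)) ^ 2) with hv
  have hu : ∀ i, ENNReal.ofReal (dropOp f m (x i) ^ 2) = v (Measure.dirac (x i)) := fun i => by
    have : x i ∈ {z | Measure.dirac z ≤ m} := hmem i
    simp [dropOp, Set.indicator_of_mem this, hv]
  have hsum : ∀ g : Z → ℝ≥0∞, Measurable g → ∫⁻ z, g z ∂m = ∑' i, g (x i) := fun g hg => by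
    rw [hm, lintegral_sum_measure]
    exact tsum_congr fun i => lintegral_dirac' _ hg
  refine le_antisymm ?_ ?_
  · -- a measurable majorant which agrees with `(D⁻F)²` at the points of `m`
    have hsep : ∀ i j : I, ∃ B : Set Z, MeasurableSet B ∧ x i ∈ B ∧
        (Measure.dirac (x j) ≠ Measure.dirac (x i) → x j ∉ B) := fun i j => by
      by_cases h : Measure.dirac (x j) = Measure.dirac (x i)
      · exact ⟨Set.univ, MeasurableSet.univ, trivial, fun h' => (h' h).elim⟩
      · by_contra! H
        exact h (dirac_eq_of_forall fun B hB hi => (H B hB hi).2)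
    choose B hB hBi hBj using hsep
    set A : I → Set Z := fun i => ⋂ j, B i j with hA
    have hAm : ∀ i, MeasurableSet (A i) := fun i => MeasurableSet.iInter fun j => hB i j
    have hAi : ∀ i, x i ∈ A i := fun i => Set.mem_iInter.2 fun j => hBi i j
    have hAj : ∀ i j, x j ∈ A i → Measure.dirac (x j) = Measure.dirac (x i) := fun i j h => by
      by_contra h'
      exact hBj i j h' (Set.mem_iInter.1 h j)
    set g : Z → ℝ≥0∞ := fun z =>
      ⨆ i, (A i).indicator (fun _ => v (Measure.dirac (x i))) z with hg
    have hgm : Measurable g := Measurable.iSup fun i => measurable_const.indicator (hAm i)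
    have hgx : ∀ j, g (x j) ≤ v (Measure.dirac (x j)) := fun j => by
      refine iSup_le fun i => ?_
      by_cases h : x j ∈ A i
      · rw [Set.indicator_of_mem h, hAj i j h]
      · rw [Set.indicator_of_notMem h]; exact bot_le
    refine (iInf₂_le_of_le g hgm (iInf_le _ ?_)).trans
      ((hsum g hgm).le.trans (ENNReal.tsum_le_tsum hgx))
    intro z
    by_cases hz : Measure.dirac z ≤ m
    · -- a point of `m` is indistinguishable from some `x i`
      have : ∃ i, Measure.dirac z = Measure.dirac (x i) := by
        by_contra! H
        have hC : ∀ i : I, ∃ C : Set Z, MeasurableSet C ∧ z ∈ C ∧ x i ∉ C := fun i => by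
          by_contra! H'
          exact H i (dirac_eq_of_forall H').symm
        choose C hC hzC hxC using hC
        have h1 := hz (⋂ i, C i)
        have hCm : MeasurableSet (⋂ i, C i) := MeasurableSet.iInter hC
        rw [hm, Measure.sum_apply _ hCm, Measure.dirac_apply' _ hCm,
          Set.indicator_of_mem (Set.mem_iInter.2 hzC)] at h1
        have h0 : ∀ i, Measure.dirac (x i) (⋂ i, C i) = 0 := fun i => by
          rw [Measure.dirac_apply' _ hCm, Set.indicator_of_notMem]
          exact fun h => hxC i (Set.mem_iInter.1 h i)
        rw [tsum_congr h0] at h1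
        simp at h1
      obtain ⟨i, hi⟩ := this
      have hzA : z ∈ A i := by
        by_contra h
        have := congrArg (fun μ => μ (A i)) hi
        simp [Measure.dirac_apply' _ (hAm i), h, hAi i] at this
      have hz' : z ∈ {z | Measure.dirac z ≤ m} := hz
      refine le_trans (le_of_eq ?_) (le_iSup _ i)
      simp [dropOp, Set.indicator_of_mem hz', Set.indicator_of_mem hzA, hv, hi]
    · have hz' : z ∉ {z | Measure.dirac z ≤ m} := hz
      simp [dropOp, Set.indicator_of_notMem hz']
  · refine le_iInf₂ fun g hg => le_iInf fun h => ?_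
    rw [hsum g hg]
    exact ENNReal.tsum_le_tsum fun i => (hu i).symm.le.trans (h (x i))

variable (η : Ω → Measure Z) (ν : Measure Z) (P : Measure Ω)

/-- `E ∫ (D⁺_z F)² ν(dz)`, with values in `[0, ∞]`. -/
noncomputable def energy (f : Measure Z → ℝ) : ℝ≥0∞ :=
  ∫⁻ ω, ∫⁻ z, ENNReal.ofReal (addOp f (η ω) z ^ 2) ∂ν ∂P

/-- The domain of the Malliavin derivative `D`. -/
def domD : Set (Measure Z → ℝ) :=
  {f | Measurable f ∧ MemLp (fun ω => f (η ω)) 2 P ∧ energy η ν P f < ∞}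

/-- The Dirichlet form `𝓔(F, G) = E ∫ D⁺_z F D⁺_z G ν(dz)`, used for `F, G ∈ dom D`. -/
noncomputable def dirichletForm (f g : Measure Z → ℝ) : ℝ :=
  ∫ p, addOp f (η p.1) p.2 * addOp g (η p.1) p.2 ∂(P.prod ν)

/-- The algebra `𝓐 = dom D ∩ L^∞(P)`. -/
def algebraA : Set (Measure Z → ℝ) :=
  {f | f ∈ domD η ν P ∧ MemLp (fun ω => f (η ω)) ∞ P}

/-- The functional carré du champ `𝚪(F)[Φ] = 𝓔(F, FΦ) - ½ 𝓔(F², Φ)` for `F, Φ ∈ 𝓐`. -/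
noncomputable def functionalGamma (f φ : Measure Z → ℝ) : ℝ :=
  dirichletForm η ν P f (fun m => f m * φ m) -
    (1 / 2) * dirichletForm η ν P (fun m => f m ^ 2) φ

/-- `u n` is a sequence in `𝓐` which converges to `f` in `dom D`. -/
def ApproximatesInDomD (u : ℕ → Measure Z → ℝ) (f : Measure Z → ℝ) : Prop :=
  (∀ n, u n ∈ algebraA η ν P) ∧
  Tendsto (fun n => eLpNorm (fun ω => u n (η ω) - f (η ω)) 2 P) atTop (𝓝 0) ∧
  Tendsto (fun n => energy η ν P (fun m => u n m - f m)) atTop (𝓝 0)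

/-- `c` is the value at `Φ ∈ 𝓐` of the continuous extension of `F ↦ 𝚪(F)[Φ]` from `𝓐` to
`F ∈ dom D`. -/
def IsGammaValue (f φ : Measure Z → ℝ) (c : ℝ) : Prop :=
  (∃ u, ApproximatesInDomD η ν P u f) ∧
  ∀ u, ApproximatesInDomD η ν P u f →
    Tendsto (fun n => functionalGamma η ν P (u n) φ) atTop (𝓝 c)

/-- `g(η) ∈ L¹(P)` is a non-negative density of the linear form `𝚪(F)`. -/
def IsCarreDuChamp (f g : Measure Z → ℝ) : Prop :=
  Measurable g ∧ (∀ᵐ ω ∂P, 0 ≤ g (η ω)) ∧ Integrable (fun ω => g (η ω)) P ∧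
  ∀ φ ∈ algebraA η ν P, IsGammaValue η ν P f φ (∫ ω, g (η ω) * φ (η ω) ∂P)

/-- The domain of the carré du champ. -/
def domGamma : Set (Measure Z → ℝ) :=
  {f | f ∈ domD η ν P ∧ ∃ g, IsCarreDuChamp η ν P f g}

end PoissonSpace

/-! For bounded $F,\Phi$, expanding the differences gives the pointwise identity behind
$\mathbf\Gamma(F)[\Phi]=\frac12\,\mathbb E\int
(D_z^+F)^2\bigl(\Phi(\eta)+\Phi(\eta+\delta_z)\bigr)\nu(\mathrm dz)$ (`functionalGamma_eq`). The
right side is a quadratic form in $D^+F$ with bounded weight, hence continuous on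
$\operatorname{dom}D$ (`tendsto_functionalGamma`), and truncation shows that $\mathcal A$ is dense
(`exists_approximatesInDomD`). The term with $\Phi(\eta)$ yields the first half of the density by
Fubini. In the term with $\Phi(\eta+\delta_z)$, the Mecke formula (`mecke`) turns $\eta+\delta_z$
into $\eta$ and $\nu$ into $\eta$, which yields the half with $D^-F$. Uniqueness holds because
$\mathcal A$ contains the indicators of cylinder events over sets of finite intensity.

The Mecke formula itself is built up from the Stein–Chen identity: one set, then disjoint sets by
independence, then cylinder functions by splitting into atoms, then all measurable functions, since
cylinder events determine finite measures (`ext_of_counts`). -/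

namespace PoissonSpace

variable {Z Ω : Type*} [MeasurableSpace Z] [MeasurableSpace Ω]

/-! ### Stein–Chen identity -/

section PoissonLaw

theorem lintegral_map_cast_poissonMeasure (r : NNReal) {g : ℝ≥0∞ → ℝ≥0∞} (hg : Measurable g) :
    ∫⁻ x, g x ∂((poissonMeasure r).map (fun k : ℕ => (k : ℝ≥0∞))) =
      ∑' n : ℕ, ENNReal.ofReal (Real.exp (-r) * r ^ n / n.factorial) * g n := by
  rw [lintegral_map hg (by fun_prop), poissonMeasure, lintegral_sum_measure]
  refine tsum_congr fun n => ?_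
  rw [lintegral_smul_measure, lintegral_dirac, smul_eq_mul]

/-- Stein–Chen identity of the Poisson distribution. -/
theorem lintegral_mul_self_poissonMeasure (r : NNReal) {g : ℝ≥0∞ → ℝ≥0∞} (hg : Measurable g) :
    ∫⁻ x, g x * x ∂((poissonMeasure r).map (fun k : ℕ => (k : ℝ≥0∞))) =
      r * ∫⁻ x, g (x + 1) ∂((poissonMeasure r).map (fun k : ℕ => (k : ℝ≥0∞))) := by
  -- The factor `x` kills the term at 0; after the shift, $(n+1)\,p_{n+1}=r\,p_n$ for the Poisson
  -- weights $p_n$.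
  rw [lintegral_map_cast_poissonMeasure r (g := fun x => g x * x) (by fun_prop),
    lintegral_map_cast_poissonMeasure r (g := fun x => g (x + 1)) (by fun_prop),
    tsum_eq_zero_add' ENNReal.summable, ← ENNReal.tsum_mul_left]
  simp only [Nat.cast_zero, mul_zero, zero_add, Nat.cast_add, Nat.cast_one]
  refine tsum_congr fun n => ?_
  have h1 : ((n : ℝ≥0∞) + 1) = ENNReal.ofReal (n + 1) := by
    rw [ENNReal.ofReal_add (by positivity) (by positivity)]; simp
  have h2 : (r : ℝ≥0∞) = ENNReal.ofReal r := by simp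
  have key : ENNReal.ofReal (Real.exp (-r) * r ^ (n + 1) / (n + 1).factorial) * ((n : ℝ≥0∞) + 1) =
      r * ENNReal.ofReal (Real.exp (-r) * r ^ n / n.factorial) := by
    rw [h1, h2, ← ENNReal.ofReal_mul (by positivity), ← ENNReal.ofReal_mul (by positivity)]
    congr 1
    rw [Nat.factorial_succ]
    push_cast
    field_simp
    ring
  rw [← mul_assoc, mul_right_comm, key, mul_assoc]

end PoissonLaw

/-! ### The σ-algebra on measures, and cylinder events -/

section Counts

/-- Measurable sets of finite intensity. -/
abbrev FiniteSets (ν : Measure Z) := {B : Set Z // MeasurableSet B ∧ ν B < ∞}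

/-- The family of the masses that a measure gives to the sets of finite intensity. -/
def counts (ν : Measure Z) (m : Measure Z) (B : FiniteSets ν) : ℝ≥0∞ := m B.1

theorem measurable_counts (ν : Measure Z) : Measurable (counts ν) :=
  measurable_pi_iff.2 fun B => Measure.measurable_coe B.2.1

/-- A partition of the space into sets of finite intensity. -/
def cell (ν : Measure Z) [SigmaFinite ν] (n : ℕ) : Set Z := disjointed (spanningSets ν) n

variable (ν : Measure Z) [SigmaFinite ν]

theorem measurableSet_cell (n : ℕ) : MeasurableSet (cell ν n) :=
  MeasurableSet.disjointed (measurableSet_spanningSets ν) n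

theorem measure_cell_lt_top (n : ℕ) : ν (cell ν n) < ∞ :=
  (measure_mono (disjointed_subset _ n)).trans_lt (measure_spanningSets_lt_top ν n)

theorem iUnion_cell : ⋃ n, cell ν n = Set.univ :=
  iUnion_disjointed.trans (iUnion_spanningSets ν)

theorem pairwise_disjoint_cell : Pairwise (Function.onFun Disjoint (cell ν)) :=
  disjoint_disjointed _

theorem measure_eq_tsum_cell (m : Measure Z) {B : Set Z} (hB : MeasurableSet B) :
    m B = ∑' n, m (B ∩ cell ν n) := by
  rw [← measure_iUnion (fun i j h => (pairwise_disjoint_cell ν h).mono Set.inter_subset_right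
    Set.inter_subset_right) fun n => hB.inter (measurableSet_cell ν n), ← Set.inter_iUnion,
    iUnion_cell, Set.inter_univ]

/-- Cutting `B` along the cells writes `m B` as a countable sum of masses of sets of finite
intensity, the only sets on which the Poisson law is prescribed. -/
theorem comap_counts :
    MeasurableSpace.comap (counts ν) MeasurableSpace.pi =
      (inferInstance : MeasurableSpace (Measure Z)) := by
  refine le_antisymm (measurable_counts ν).comap_le ?_
  refine iSup₂_le fun B hB => ?_
  rw [← measurable_iff_comap_le]
  let C : ℕ → FiniteSets ν := fun n => ⟨B ∩ cell ν n, hB.inter (measurableSet_cell ν n),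
    (measure_mono Set.inter_subset_right).trans_lt (measure_cell_lt_top ν n)⟩
  have hC : (fun m : Measure Z => m B) =
      (fun x : FiniteSets ν → ℝ≥0∞ => ∑' n, x (C n)) ∘ counts ν :=
    funext fun m => measure_eq_tsum_cell ν m hB
  rw [hC]
  exact (Measurable.tsum fun n => measurable_pi_apply (C n)).comp (comap_measurable (counts ν))

/-- Finite measures on the space of measures are determined by the joint laws of the masses of
finitely many sets of finite intensity. -/
theorem ext_of_counts {ρ₁ ρ₂ : Measure (Measure Z)} [IsFiniteMeasure ρ₁] [IsFiniteMeasure ρ₂]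
    (h : ∀ (J : Finset (FiniteSets ν)) (S : Set (J → ℝ≥0∞)), MeasurableSet S →
      ρ₁ {m | (fun B : J => m B.1.1) ∈ S} = ρ₂ {m | (fun B : J => m B.1.1) ∈ S}) : ρ₁ = ρ₂ := by
  have hmap : ρ₁.map (counts ν) = ρ₂.map (counts ν) := by
    -- On the product space a finite measure is determined by its finite-dimensional marginals.
    refine IsProjectiveLimit.unique (P := fun J => (ρ₂.map (counts ν)).map J.restrict) ?_
      fun J => rfl
    intro J
    ext S hS
    have hJ : Measurable (J.restrict : (FiniteSets ν → ℝ≥0∞) → J → ℝ≥0∞) := by fun_prop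
    rw [Measure.map_apply hJ hS, Measure.map_apply hJ hS,
      Measure.map_apply (measurable_counts ν) (hJ hS),
      Measure.map_apply (measurable_counts ν) (hJ hS)]
    exact h J S hS
  ext A hA
  have hA' : MeasurableSet[MeasurableSpace.comap (counts ν) MeasurableSpace.pi] A := by
    rw [comap_counts ν]; exact hA
  obtain ⟨S, hS, rfl⟩ := hA'
  rw [← Measure.map_apply (measurable_counts ν) hS, hmap,
    Measure.map_apply (measurable_counts ν) hS]

end Counts

/-! ### Mecke formula for finitely many sets -/

section MeckeCylinder

variable {η : Ω → Measure Z} {ν : Measure Z} {P : Measure Ω}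

theorem IsPoissonProcess.measurable_apply (hη : IsPoissonProcess η ν P) {B : Set Z}
    (hB : MeasurableSet B) : Measurable fun ω => η ω B :=
  (Measure.measurable_coe hB).comp hη.measurable

theorem IsPoissonProcess.iIndepFun_of_fintype (hη : IsPoissonProcess η ν P) {α : Type*} [Fintype α]
    {C : α → Set Z} (hC : ∀ a, MeasurableSet (C a))
    (hd : Pairwise fun a b => Disjoint (C a) (C b)) :
    iIndepFun (fun a ω => η ω (C a)) P := by
  let e := Fintype.equivFin α
  have := hη.indep (Fintype.card α) (fun i => C (e.symm i)) (fun i => hC _)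
    fun i j hij => hd (e.symm.injective.ne hij)
  simpa [Function.comp_def] using this.precomp e.injective

theorem IsPoissonProcess.lintegral_mul_self (hη : IsPoissonProcess η ν P) {B : Set Z}
    (hB : MeasurableSet B) (hB' : ν B < ∞) {g : ℝ≥0∞ → ℝ≥0∞} (hg : Measurable g) :
    ∫⁻ ω, g (η ω B) * η ω B ∂P = ν B * ∫⁻ ω, g (η ω B + 1) ∂P := by
  have h1 := lintegral_map (μ := P) (f := fun x => g x * x) (by fun_prop) (hη.measurable_apply hB)
  have h2 := lintegral_map (μ := P) (f := fun x => g (x + 1)) (by fun_prop) (hη.measurable_apply hB)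
  have h3 := lintegral_mul_self_poissonMeasure (ν B).toNNReal hg
  rw [hη.law B hB hB'] at h1 h2
  rw [← h1, ← h2, h3, ENNReal.coe_toNNReal hB'.ne]

variable [IsProbabilityMeasure P]

theorem IsPoissonProcess.lintegral_apply (hη : IsPoissonProcess η ν P) {B : Set Z}
    (hB : MeasurableSet B) (hB' : ν B < ∞) : ∫⁻ ω, η ω B ∂P = ν B := by
  simpa using hη.lintegral_mul_self hB hB' (g := fun _ => 1) measurable_const

/-- On boxes independence factorizes both sides, and they differ only in factor `j`, where
Stein–Chen applies. Boxes form a π-system, so the two finite measures coincide. -/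
theorem IsPoissonProcess.lintegral_atoms (hη : IsPoissonProcess η ν P) {α : Type*} [Fintype α]
    [DecidableEq α]
    {C : α → Set Z} (hC : ∀ a, MeasurableSet (C a)) (hd : Pairwise fun a b => Disjoint (C a) (C b))
    (j : α) (hj : ν (C j) < ∞) {G : (α → ℝ≥0∞) → ℝ≥0∞} (hG : Measurable G) :
    ∫⁻ ω, G (fun a => η ω (C a)) * η ω (C j) ∂P =
      ν (C j) * ∫⁻ ω, G (fun a => η ω (C a) + if a = j then 1 else 0) ∂P := by
  have hX : ∀ a, Measurable fun ω => η ω (C a) := fun a => hη.measurable_apply (hC a)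
  have hXv : Measurable fun ω a => η ω (C a) := measurable_pi_iff.2 hX
  have hYv : Measurable fun ω a => η ω (C a) + if a = j then 1 else 0 :=
    measurable_pi_iff.2 fun a => (hX a).add_const _
  have hind := hη.iIndepFun_of_fintype hC hd
  have hbox : ∀ s : α → Set ℝ≥0∞, (∀ a, MeasurableSet (s a)) →
      ∫⁻ ω, (Set.univ.pi s).indicator 1 (fun a => η ω (C a)) * η ω (C j) ∂P =
      ν (C j) * ∫⁻ ω, (Set.univ.pi s).indicator 1
        (fun a => η ω (C a) + if a = j then 1 else 0) ∂P := by
    intro s hs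
    have hind1 : ∀ x : α → ℝ≥0∞, (Set.univ.pi s).indicator (1 : (α → ℝ≥0∞) → ℝ≥0∞) x =
        ∏ a, (s a).indicator 1 (x a) := by
      intro x
      by_cases hx : x ∈ Set.univ.pi s
      · rw [Set.indicator_of_mem hx, Finset.prod_eq_one]
        · rfl
        · intro a _
          rw [Set.indicator_of_mem (hx a trivial)]; rfl
      · rw [Set.indicator_of_notMem hx]
        simp only [Set.mem_univ_pi, not_forall] at hx
        obtain ⟨a, ha⟩ := hx
        exact (Finset.prod_eq_zero (Finset.mem_univ a) (Set.indicator_of_notMem ha _)).symm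
    have hm : ∀ a, Measurable ((s a).indicator (1 : ℝ≥0∞ → ℝ≥0∞)) := fun a =>
      measurable_one.indicator (hs a)
    let g : α → ℝ≥0∞ → ℝ≥0∞ := fun a x => (s a).indicator 1 x * if a = j then x else 1
    have hg : ∀ a, Measurable (g a) := fun a => by
      by_cases h : a = j
      · subst h; simpa [g] using (hm a).fun_mul measurable_id
      · simpa [g, h] using hm a
    let k : α → ℝ≥0∞ → ℝ≥0∞ := fun a x => (s a).indicator 1 (x + if a = j then 1 else 0)
    have hk : ∀ a, Measurable (k a) := fun a => (hm a).comp (measurable_id.add_const _)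
    have e1 : ∀ ω, (Set.univ.pi s).indicator (1 : (α → ℝ≥0∞) → ℝ≥0∞)
        (fun a => η ω (C a)) * η ω (C j) =
        ∏ a, g a (η ω (C a)) := fun ω => by
      simp only [g, Finset.prod_mul_distrib, hind1, Finset.prod_ite_eq', Finset.mem_univ, if_true]
    have e2 : ∀ ω, (Set.univ.pi s).indicator (1 : (α → ℝ≥0∞) → ℝ≥0∞)
        (fun a => η ω (C a) + if a = j then 1 else 0) = ∏ a, k a (η ω (C a)) := fun ω => by
      rw [hind1]
    simp_rw [e1, e2]
    have i1 := lintegral_prod_eq_prod_lintegral_of_indepFun Finset.univ _ (hind.comp g hg)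
      fun a => (hg a).comp (hX a)
    have i2 := lintegral_prod_eq_prod_lintegral_of_indepFun Finset.univ _ (hind.comp k hk)
      fun a => (hk a).comp (hX a)
    simp only [Function.comp] at i1 i2
    rw [i1, i2, ← Finset.mul_prod_erase _ _ (Finset.mem_univ j),
      ← Finset.mul_prod_erase Finset.univ (fun a => ∫⁻ ω, k a (η ω (C a)) ∂P) (Finset.mem_univ j),
      ← mul_assoc]
    congr 1
    · simpa [g, k] using hη.lintegral_mul_self (hC j) hj (hm j)
    · refine Finset.prod_congr rfl fun a ha => ?_
      have : a ≠ j := Finset.ne_of_mem_erase ha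
      simp [g, k, this]
  have hfin1 : IsFiniteMeasure ((P.withDensity fun ω => η ω (C j)).map fun ω a => η ω (C a)) := by
    have : IsFiniteMeasure (P.withDensity fun ω => η ω (C j)) :=
      isFiniteMeasure_withDensity (by rw [hη.lintegral_apply (hC j) hj]; exact hj.ne)
    infer_instance
  have hmeas : (P.withDensity fun ω => η ω (C j)).map (fun ω a => η ω (C a)) =
      ν (C j) • P.map (fun ω a => η ω (C a) + if a = j then 1 else 0) := by
    have key : ∀ s : α → Set ℝ≥0∞, (∀ a, MeasurableSet (s a)) →
        (P.withDensity fun ω => η ω (C j)).map (fun ω a => η ω (C a)) (Set.univ.pi s) =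
        (ν (C j) • P.map (fun ω a => η ω (C a) + if a = j then 1 else 0)) (Set.univ.pi s) := by
      intro s hs
      have hS : MeasurableSet (Set.univ.pi s) := MeasurableSet.univ_pi hs
      have h1 : Measurable ((Set.univ.pi s).indicator (1 : (α → ℝ≥0∞) → ℝ≥0∞)) :=
        measurable_one.indicator hS
      rw [← lintegral_indicator_one hS, ← lintegral_indicator_one hS, lintegral_map h1 hXv,
        lintegral_withDensity_eq_lintegral_mul _ (hX j) (h1.fun_comp hXv), lintegral_smul_measure,
        lintegral_map h1 hYv, smul_eq_mul, ← hbox s hs]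
      refine lintegral_congr fun ω => ?_
      rw [Pi.mul_apply, mul_comm]
    refine ext_of_generate_finite _ generateFrom_pi.symm
      (isPiSystem_pi (α := fun _ : α => ℝ≥0∞)) ?_ ?_
    · rintro _ ⟨s, hs, rfl⟩
      exact key s fun a => hs a trivial
    · simpa using key (fun _ => Set.univ) fun _ => MeasurableSet.univ
  have := congrArg (fun μ => ∫⁻ x, G x ∂μ) hmeas
  rw [lintegral_map hG hXv, lintegral_withDensity_eq_lintegral_mul _ (hX j) (hG.fun_comp hXv),
    lintegral_smul_measure, lintegral_map hG hYv, smul_eq_mul] at this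
  rw [← this]
  refine lintegral_congr fun ω => ?_
  rw [Pi.mul_apply, mul_comm]

/-- Mecke formula for cylindrical functions. -/
theorem IsPoissonProcess.lintegral_cylinder (hη : IsPoissonProcess η ν P)
    (J : Finset (FiniteSets ν)) (B : J) {G : (J → ℝ≥0∞) → ℝ≥0∞} (hG : Measurable G) :
    ∫⁻ ω, G (fun b => η ω b.1.1) * η ω B.1.1 ∂P =
      ∫⁻ ω, ∫⁻ z in B.1.1, G (fun b => (η ω + Measure.dirac z) b.1.1) ∂ν ∂P := by
  classical
  -- `τ x` records which sets of `J` contain `x`; its fibres `C ε` are the disjoint atoms of the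
  -- algebra generated by `J`.
  let τ : Z → J → Prop := fun x b => x ∈ b.1.1
  let C : (J → Prop) → Set Z := fun ε => τ ⁻¹' {ε}
  have hC : ∀ ε, MeasurableSet (C ε) := fun ε => by
    have : C ε = ⋂ b : J, {x | x ∈ b.1.1 ↔ ε b} := by
      ext x
      simp [C, τ, funext_iff]
    rw [this]
    refine MeasurableSet.iInter fun b => ?_
    by_cases h : ε b
    · simpa only [h, iff_true, Set.ofPred_mem_eq] using b.1.2.1
    · simpa only [h, iff_false] using! b.1.2.1.compl
  have hd : Pairwise fun a b => Disjoint (C a) (C b) := fun a b hab => by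
    refine Set.disjoint_left.2 fun x hx hx' => hab ?_
    rw [← show τ x = a from hx, ← show τ x = b from hx']
  let E : J → Finset (J → Prop) := fun b => Finset.univ.filter fun ε => ε b
  have hE : ∀ b : J, b.1.1 = ⋃ ε ∈ E b, C ε := fun b => by
    ext x
    simp [E, C, τ]
  have hsum : ∀ (m : Measure Z) (b : J), m b.1.1 = ∑ ε ∈ E b, m (C ε) := fun m b => by
    conv_lhs => rw [hE b]
    exact measure_biUnion_finset (fun a _ b _ h => hd h) fun ε _ => hC ε
  let L : ((J → Prop) → ℝ≥0∞) → J → ℝ≥0∞ := fun x b => ∑ ε ∈ E b, x ε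
  have hL : Measurable L := measurable_pi_iff.2 fun b =>
    Finset.measurable_sum _ fun ε _ => measurable_pi_apply ε
  have hmL : ∀ m : Measure Z, (fun b : J => m b.1.1) = L fun ε => m (C ε) := fun m =>
    funext fun b => hsum m b
  -- Only atoms inside `B` are covered: the atom outside all sets of `J` may have infinite
  -- intensity.
  have hfin : ∀ ε ∈ E B, ν (C ε) < ∞ := fun ε hε => by
    refine (measure_mono ?_).trans_lt B.1.2.2
    conv_rhs => rw [hE B]
    exact Set.subset_biUnion_of_mem (u := C) hε
  have hGL : Measurable fun x => G (L x) := hG.comp hL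
  have hX : ∀ a, Measurable fun ω => η ω (C a) := fun a => hη.measurable_apply (hC a)
  have hYv : ∀ j, Measurable fun ω a => η ω (C a) + if a = j then 1 else 0 := fun j =>
    measurable_pi_iff.2 fun a => (hX a).add_const _
  have hR : ∀ ω, ∫⁻ z in B.1.1, G (fun b => (η ω + Measure.dirac z) b.1.1) ∂ν =
      ∑ ε ∈ E B, ν (C ε) * G (L fun a => η ω (C a) + if a = ε then 1 else 0) := fun ω => by
    conv_lhs => rw [hE B]
    rw [lintegral_biUnion_finset (fun a _ b _ h => hd h) fun ε _ => hC ε]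
    refine Finset.sum_congr rfl fun ε _ => ?_
    rw [mul_comm, ← setLIntegral_const]
    refine setLIntegral_congr_fun (hC ε) fun z hz => ?_
    rw [hmL]
    -- For `z` in the atom `C ε`, adding `δ_z` raises the mass of that atom by 1 and of no other.
    congr 2
    funext a
    rw [Measure.add_apply, Measure.dirac_apply' _ (hC a)]
    congr 1
    have hz' : τ z = ε := hz
    by_cases h : a = ε
    · have : z ∈ C a := by rw [h]; exact hz
      rw [Set.indicator_of_mem this, if_pos h]; rfl
    · have : z ∉ C a := fun h' => h (by rw [← hz']; exact (show τ z = a from h').symm)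
      rw [Set.indicator_of_notMem this, if_neg h]
  simp_rw [hR]
  have hLm : ∀ ω, G (fun b : J => η ω b.1.1) * η ω B.1.1 =
      ∑ ε ∈ E B, G (L fun a => η ω (C a)) * η ω (C ε) := fun ω => by
    rw [hmL, hsum, Finset.mul_sum]
  simp_rw [hLm]
  rw [lintegral_finsetSum _ fun ε _ => (hGL.fun_comp (measurable_pi_iff.2 hX)).fun_mul (hX ε),
    lintegral_finsetSum _ fun ε _ => (hGL.fun_comp (hYv ε)).const_mul _]
  refine Finset.sum_congr rfl fun ε hε => ?_
  rw [lintegral_const_mul _ (hGL.fun_comp (hYv ε))]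
  exact hη.lintegral_atoms hC hd ε (hfin ε hε) hGL

end MeckeCylinder

/-! ### The point process as an s-finite kernel -/

section EvalKernel

variable (ν : Measure Z) [SigmaFinite ν]

theorem measurableSet_massSlice (n k : ℕ) :
    MeasurableSet {m : Measure Z | m (cell ν n) ∈ Set.Ico (k : ℝ≥0∞) (k + 1)} :=
  Measure.measurable_coe (measurableSet_cell ν n) measurableSet_Ico

open Classical in
/-- The kernel `m ↦ m` restricted to the `n`-th cell and to those `m` that give to this cell a
mass in `[k, k + 1)`. -/
noncomputable def sliceKernel (n k : ℕ) : Kernel (Measure Z) Z :=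
  Kernel.piecewise (measurableSet_massSlice ν n k)
    ((⟨id, measurable_id⟩ : Kernel (Measure Z) Z).restrict (measurableSet_cell ν n)) 0

theorem sliceKernel_apply_of_mem {n k : ℕ} {m : Measure Z}
    (h : m (cell ν n) ∈ Set.Ico (k : ℝ≥0∞) (k + 1)) :
    sliceKernel ν n k m = m.restrict (cell ν n) := by
  classical
  rw [sliceKernel, Kernel.piecewise_apply, if_pos (by exact h), Kernel.restrict_apply]
  rfl

theorem sliceKernel_apply_of_notMem {n k : ℕ} {m : Measure Z}
    (h : m (cell ν n) ∉ Set.Ico (k : ℝ≥0∞) (k + 1)) : sliceKernel ν n k m = 0 := by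
  classical
  rw [sliceKernel, Kernel.piecewise_apply, if_neg (by exact h)]
  rfl

/-- A finite kernel needs a bound uniform in `m`; slicing by the mass of the cell provides `k + 1`.
-/
instance (n k : ℕ) : IsFiniteKernel (sliceKernel ν n k) := by
  refine ⟨⟨k + 1, by finiteness, fun m => ?_⟩⟩
  by_cases h : m (cell ν n) ∈ Set.Ico (k : ℝ≥0∞) (k + 1)
  · rw [sliceKernel_apply_of_mem ν h, Measure.restrict_apply_univ]
    exact h.2.le
  · rw [sliceKernel_apply_of_notMem ν h]
    simp

/-- The kernel `m ↦ m` on the measures that are finite on the cells, as an s-finite kernel. -/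
noncomputable def evalKernel : Kernel (Measure Z) Z :=
  Kernel.sum fun p : ℕ × ℕ => sliceKernel ν p.1 p.2

instance : IsSFiniteKernel (evalKernel ν) :=
  Kernel.isSFiniteKernel_sum

theorem evalKernel_apply {m : Measure Z} (hm : ∀ n, m (cell ν n) ≠ ∞) : evalKernel ν m = m := by
  ext B hB
  rw [evalKernel, Kernel.sum_apply' _ _ hB, ENNReal.tsum_prod', measure_eq_tsum_cell ν m hB]
  refine tsum_congr fun n => ?_
  have key : ∀ k : ℕ, m (cell ν n) ∈ Set.Ico (k : ℝ≥0∞) (k + 1) ↔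
      k = ⌊(m (cell ν n)).toNNReal⌋₊ := fun k => by
    rw [eq_comm, Nat.floor_eq_iff zero_le, Set.mem_Ico, ← ENNReal.coe_toNNReal (hm n)]
    norm_cast
  rw [tsum_eq_single ⌊(m (cell ν n)).toNNReal⌋₊, sliceKernel_apply_of_mem ν ((key _).2 rfl),
    Measure.restrict_apply hB]
  intro k hk
  rw [sliceKernel_apply_of_notMem ν fun h => hk ((key k).1 h)]
  rfl

end EvalKernel

/-! ### Mecke formula in full generality -/

section Mecke

variable {η : Ω → Measure Z} {ν : Measure Z} {P : Measure Ω}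

theorem measurable_add_dirac :
    Measurable fun p : Measure Z × Z => p.1 + Measure.dirac p.2 := by
  refine Measure.measurable_of_measurable_coe _ fun B hB => ?_
  simp only [Measure.add_apply]
  exact ((Measure.measurable_coe hB).comp measurable_fst).add
    ((Measure.measurable_coe hB).comp (Measure.measurable_dirac.comp measurable_snd))

theorem IsPoissonProcess.measurable_add_dirac (hη : IsPoissonProcess η ν P) :
    Measurable fun p : Ω × Z => η p.1 + Measure.dirac p.2 :=
  PoissonSpace.measurable_add_dirac.comp
    ((hη.measurable.comp measurable_fst).prodMk measurable_snd)

variable [SigmaFinite ν] [IsProbabilityMeasure P]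

theorem IsPoissonProcess.ae_evalKernel_eq (hη : IsPoissonProcess η ν P) :
    ∀ᵐ ω ∂P, evalKernel ν (η ω) = η ω := by
  have : ∀ n, ∀ᵐ ω ∂P, η ω (cell ν n) < ∞ := fun n =>
    ae_lt_top (hη.measurable_apply (measurableSet_cell ν n)) (by
      rw [hη.lintegral_apply (measurableSet_cell ν n) (measure_cell_lt_top ν n)]
      exact (measure_cell_lt_top ν n).ne)
  filter_upwards [ae_all_iff.2 this] with ω hω
  exact evalKernel_apply ν fun n => (hω n).ne

/-- This is the Mecke formula with the added point confined to `C`. Both sides are finite measures,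
so cylinder events suffice. -/
theorem IsPoissonProcess.map_withDensity_eq (hη : IsPoissonProcess η ν P) {C : Set Z}
    (hC : MeasurableSet C) (hC' : ν C < ∞) :
    (P.withDensity fun ω => η ω C).map η =
      (P.prod (ν.restrict C)).map fun p => η p.1 + Measure.dirac p.2 := by
  classical
  have : IsFiniteMeasure (P.withDensity fun ω => η ω C) :=
    isFiniteMeasure_withDensity (by rw [hη.lintegral_apply hC hC']; exact hC'.ne)
  have : IsFiniteMeasure (ν.restrict C) := isFiniteMeasure_restrict.2 hC'.ne
  refine ext_of_counts ν fun J S hS => ?_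
  -- `C` joins the coordinates so that the weight `η ω C` is itself one of the counts.
  let K : Finset (FiniteSets ν) := insert ⟨C, hC, hC'⟩ J
  let B : K := ⟨⟨C, hC, hC'⟩, Finset.mem_insert_self _ _⟩
  let ι : J → K := fun b => ⟨b.1, Finset.mem_insert_of_mem b.2⟩
  let G : (K → ℝ≥0∞) → ℝ≥0∞ := fun x => S.indicator 1 fun b => x (ι b)
  have hG : Measurable G := (measurable_one.indicator hS).comp
    (measurable_pi_iff.2 fun b => measurable_pi_apply (ι b))
  have hT : MeasurableSet {m : Measure Z | (fun b : J => m b.1.1) ∈ S} :=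
    (measurable_pi_iff.2 fun b : J => Measure.measurable_coe b.1.2.1) hS
  have key := hη.lintegral_cylinder K B hG
  rw [Measure.map_apply hη.measurable hT, withDensity_apply _ (hη.measurable hT),
    ← lintegral_indicator (hη.measurable hT), ← lintegral_indicator_one hT,
    lintegral_map (measurable_one.indicator hT) hη.measurable_add_dirac,
    lintegral_prod _
      (((measurable_one.indicator hT).fun_comp hη.measurable_add_dirac).aemeasurable)]
  refine Eq.trans (lintegral_congr fun ω => ?_) key
  by_cases h : (fun b : J => η ω b.1.1) ∈ S
  · have h1 : ω ∈ η ⁻¹' {m : Measure Z | (fun b : J => m b.1.1) ∈ S} := h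
    have h2 : (fun b : J => η ω (ι b).1.1) ∈ S := h
    simp only [G]
    rw [Set.indicator_of_mem h1, Set.indicator_of_mem h2, Pi.one_apply, one_mul]
  · have h1 : ω ∉ η ⁻¹' {m : Measure Z | (fun b : J => m b.1.1) ∈ S} := h
    have h2 : (fun b : J => η ω (ι b).1.1) ∉ S := h
    simp only [G]
    rw [Set.indicator_of_notMem h1, Set.indicator_of_notMem h2, zero_mul]

/-- Mecke formula, as an identity of measures. -/
theorem IsPoissonProcess.mecke (hη : IsPoissonProcess η ν P) :
    (P.map η) ⊗ₘ (evalKernel ν) =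
      (P.prod ν).map fun p => (η p.1 + Measure.dirac p.2, p.2) := by
  have : IsProbabilityMeasure (P.map η) :=
    Measure.isProbabilityMeasure_map hη.measurable.aemeasurable
  have hΦ : Measurable fun p : Ω × Z => (η p.1 + Measure.dirac p.2, p.2) :=
    hη.measurable_add_dirac.prodMk measurable_snd
  have key : ∀ (A : Set (Measure Z)) (C : Set Z), MeasurableSet A → MeasurableSet C → ν C < ∞ →
      ((P.map η) ⊗ₘ (evalKernel ν)) (A ×ˢ C) =
        ((P.prod ν).map fun p => (η p.1 + Measure.dirac p.2, p.2)) (A ×ˢ C) := by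
    intro A C hA hC hC'
    have h1 := congrArg (fun ρ => ρ A) (hη.map_withDensity_eq hC hC')
    rw [Measure.map_apply hη.measurable hA, withDensity_apply _ (hη.measurable hA),
      Measure.map_apply hη.measurable_add_dirac hA] at h1
    rw [Measure.compProd_apply_prod hA hC, setLIntegral_map hA (Kernel.measurable_coe _ hC)
      hη.measurable, Measure.map_apply hΦ (hA.prod hC)]
    have h2 : ∫⁻ ω in η ⁻¹' A, evalKernel ν (η ω) C ∂P = ∫⁻ ω in η ⁻¹' A, η ω C ∂P :=
      lintegral_congr_ae <| ae_restrict_of_ae <| hη.ae_evalKernel_eq.mono fun ω h => by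
        simp only [h]
    rw [h2, h1]
    have h3 : P.prod (ν.restrict C) = (P.prod ν).restrict (Set.univ ×ˢ C) := by
      rw [← Measure.prod_restrict, Measure.restrict_univ]
    rw [h3, Measure.restrict_apply (hη.measurable_add_dirac hA)]
    congr 1
    ext p
    simp
  -- Rectangles determine finite measures only, so the comparison is made cell by cell.
  refine Measure.ext_of_iUnion_eq_univ (s := fun n => Set.univ ×ˢ cell ν n) ?_ fun n => ?_
  · rw [← Set.prod_iUnion, iUnion_cell, Set.univ_prod_univ]
  · have hn : MeasurableSet ((Set.univ : Set (Measure Z)) ×ˢ cell ν n) :=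
      MeasurableSet.univ.prod (measurableSet_cell ν n)
    have : IsFiniteMeasure (((P.map η) ⊗ₘ (evalKernel ν)).restrict (Set.univ ×ˢ cell ν n)) := by
      refine isFiniteMeasure_restrict.2 ?_
      rw [Measure.compProd_apply_prod MeasurableSet.univ (measurableSet_cell ν n),
        setLIntegral_univ, lintegral_map (Kernel.measurable_coe _ (measurableSet_cell ν n))
        hη.measurable]
      have h2 : ∫⁻ ω, evalKernel ν (η ω) (cell ν n) ∂P = ∫⁻ ω, η ω (cell ν n) ∂P :=
        lintegral_congr_ae <| hη.ae_evalKernel_eq.mono fun ω h => by simp only [h]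
      rw [h2, hη.lintegral_apply (measurableSet_cell ν n) (measure_cell_lt_top ν n)]
      exact (measure_cell_lt_top ν n).ne
    refine Measure.ext_prod fun {A} {B} hA hB => ?_
    rw [Measure.restrict_apply (hA.prod hB), Measure.restrict_apply (hA.prod hB),
      Set.prod_inter_prod, Set.inter_univ]
    exact key A _ hA (hB.inter (measurableSet_cell ν n))
      ((measure_mono Set.inter_subset_right).trans_lt (measure_cell_lt_top ν n))

/-- Adding a point to the process does not charge the null events of the process. -/
theorem IsPoissonProcess.ae_add_dirac (hη : IsPoissonProcess η ν P) {p : Measure Z → Prop}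
    (hp : MeasurableSet {m | p m}) (h : ∀ᵐ ω ∂P, p (η ω)) :
    ∀ᵐ q ∂(P.prod ν), p (η q.1 + Measure.dirac q.2) := by
  have h1 : ∀ᵐ m ∂(P.map η), p m := (ae_map_iff hη.measurable.aemeasurable hp).2 h
  have : IsProbabilityMeasure (P.map η) :=
    Measure.isProbabilityMeasure_map hη.measurable.aemeasurable
  -- On the kernel side of the Mecke formula, the first coordinate does not charge null sets of the
  -- law of `η`.
  have h2 : ∀ᵐ q ∂((P.map η) ⊗ₘ (evalKernel ν)), p q.1 :=
    Measure.ae_compProd_of_ae_fst _ hp h1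
  rw [hη.mecke] at h2
  exact ae_of_ae_map (hη.measurable_add_dirac.prodMk measurable_snd).aemeasurable h2

end Mecke

/-! ### Removing a point measurably -/

section Removal

/-- `f (m - δ_z)` has a jointly measurable version on the pairs with `δ_z ≤ m`. -/
theorem exists_removal (ν : Measure Z) [SigmaFinite ν] {f : Measure Z → ℝ} (hf : Measurable f) :
    ∃ r : Measure Z × Z → ℝ, Measurable r ∧ ∀ m z, r (m + Measure.dirac z, z) = f m := by
  have hf' : Measurable[MeasurableSpace.comap (counts ν) MeasurableSpace.pi] f := by
    rw [comap_counts]; exact hf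
  obtain ⟨h, hh, rfl⟩ := hf'.exists_eq_measurable_comp
  -- `f` factors through the counts, where subtraction is measurable. As `δ_z` has finite mass,
  -- adding and then subtracting it cancels even if `m B = ∞`.
  refine ⟨fun p => h fun B => p.1 B.1 - Measure.dirac p.2 B.1, hh.comp ?_, fun m z => ?_⟩
  · refine measurable_pi_iff.2 fun B => ?_
    exact ((Measure.measurable_coe B.2.1).comp measurable_fst).sub
      ((Measure.measurable_coe B.2.1).comp (Measure.measurable_dirac.comp measurable_snd))
  · simp only [Function.comp]
    congr 1
    funext B
    rw [Measure.add_apply, ENNReal.add_sub_cancel_right (measure_ne_top _ _)]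
    rfl

theorem IsProper.upperIntegral_dropOp_sq {m : Measure Z} (hm : IsProper m) {f : Measure Z → ℝ}
    {r : Measure Z × Z → ℝ} (hr : Measurable r)
    (hrf : ∀ m z, r (m + Measure.dirac z, z) = f m) :
    upperIntegral m (fun z => ENNReal.ofReal (dropOp f m z ^ 2)) =
      ∫⁻ z, ENNReal.ofReal ((f m - r (m, z)) ^ 2) ∂m := by
  obtain ⟨I, x, hx⟩ := hm
  have hmeas : Measurable fun z => ENNReal.ofReal ((f m - r (m, z)) ^ 2) := by fun_prop
  rw [PoissonSpace.upperIntegral_dropOp_sq f x m hx]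
  conv_rhs => rw [hx]
  rw [lintegral_sum_measure, ← hx]
  refine tsum_congr fun i => ?_
  rw [lintegral_dirac' _ hmeas]
  have hi : Measure.dirac (x i) ≤ m := by
    rw [hx]; exact Measure.le_sum (fun i => Measure.dirac (x i)) i
  -- Writing `m` as `(m - δ) + δ` brings `r` into the form in which its value is known.
  conv_rhs => rw [← Measure.sub_add_cancel_of_le hi, hrf, Measure.sub_add_cancel_of_le hi]

end Removal

/-! ### The functional carré du champ and its continuity -/

section Energy

theorem eLpNorm_two_eq {α : Type*} [MeasurableSpace α] (μ : Measure α) (u : α → ℝ) :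
    eLpNorm u 2 μ = (∫⁻ x, ENNReal.ofReal (u x ^ 2) ∂μ) ^ (1 / 2 : ℝ) := by
  rw [eLpNorm_eq_lintegral_rpow_enorm_toReal (by norm_num) (by norm_num)]
  simp only [ENNReal.toReal_ofNat]
  congr 1
  refine lintegral_congr fun x => ?_
  rw [← enorm_norm, Real.enorm_of_nonneg (norm_nonneg _), ENNReal.ofReal_rpow_of_nonneg
    (norm_nonneg _) (by norm_num)]
  norm_num

theorem tendsto_eLpNorm_two_iff {α ι : Type*} [MeasurableSpace α] {μ : Measure α} {l : Filter ι}
    {u : ι → α → ℝ} : Tendsto (fun i => eLpNorm (u i) 2 μ) l (𝓝 0) ↔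
      Tendsto (fun i => ∫⁻ x, ENNReal.ofReal (u i x ^ 2) ∂μ) l (𝓝 0) := by
  simp only [eLpNorm_two_eq]
  constructor
  · intro h
    have := ((ENNReal.continuous_rpow_const (y := 2)).tendsto 0).comp h
    simp only [Function.comp_def, ← ENNReal.rpow_mul] at this
    norm_num at this
    exact this
  · intro h
    have := ((ENNReal.continuous_rpow_const (y := (1 / 2 : ℝ))).tendsto 0).comp h
    simpa [Function.comp_def] using this

theorem measurable_addOp {f : Measure Z → ℝ} (hf : Measurable f) :
    Measurable fun p : Measure Z × Z => addOp f p.1 p.2 :=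
  (hf.comp measurable_add_dirac).sub (hf.comp measurable_fst)

variable {η : Ω → Measure Z} {ν : Measure Z} {P : Measure Ω}

theorem IsPoissonProcess.measurable_addOp (hη : IsPoissonProcess η ν P) {f : Measure Z → ℝ}
    (hf : Measurable f) : Measurable fun p : Ω × Z => addOp f (η p.1) p.2 :=
  (PoissonSpace.measurable_addOp hf).comp
    ((hη.measurable.comp measurable_fst).prodMk measurable_snd)

theorem exists_bound_of_memLp_top {u : Ω → ℝ} (hu : MemLp u ∞ P) :
    ∃ K : ℝ, ∀ᵐ ω ∂P, ‖u ω‖ ≤ K := by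
  refine ⟨(eLpNormEssSup u P).toReal, ?_⟩
  have h : eLpNormEssSup u P ≠ ∞ := by simpa using hu.2.ne
  filter_upwards [ae_le_eLpNormEssSup (f := u) (μ := P)] with ω hω
  simpa using ENNReal.toReal_mono h hω

variable [SigmaFinite ν]

theorem IsPoissonProcess.energy_eq (hη : IsPoissonProcess η ν P) {f : Measure Z → ℝ}
    (hf : Measurable f) :
    energy η ν P f = ∫⁻ p, ENNReal.ofReal (addOp f (η p.1) p.2 ^ 2) ∂(P.prod ν) := by
  rw [lintegral_prod _ ((hη.measurable_addOp hf).pow_const 2).ennreal_ofReal.aemeasurable]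
  rfl

theorem IsPoissonProcess.memLp_addOp (hη : IsPoissonProcess η ν P) {f : Measure Z → ℝ}
    (hf : f ∈ domD η ν P) : MemLp (fun p : Ω × Z => addOp f (η p.1) p.2) 2 (P.prod ν) := by
  refine ⟨(hη.measurable_addOp hf.1).aestronglyMeasurable, ?_⟩
  rw [eLpNorm_two_eq, ← hη.energy_eq hf.1]
  exact ENNReal.rpow_lt_top_of_nonneg (by norm_num) hf.2.2.ne

variable [IsProbabilityMeasure P]

/-- A bounded functional stays bounded after addition of a point. -/
theorem IsPoissonProcess.memLp_top_prod (hη : IsPoissonProcess η ν P) {φ : Measure Z → ℝ}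
    (hφ : Measurable φ) (hφ' : MemLp (fun ω => φ (η ω)) ∞ P) :
    MemLp (fun p : Ω × Z => φ (η p.1)) ∞ (P.prod ν) ∧
      MemLp (fun p : Ω × Z => φ (η p.1 + Measure.dirac p.2)) ∞ (P.prod ν) := by
  obtain ⟨K, hK⟩ := exists_bound_of_memLp_top hφ'
  have h1 : ∀ᵐ p ∂(P.prod ν), ‖φ (η p.1)‖ ≤ K :=
    Measure.quasiMeasurePreserving_fst.ae hK
  have h2 : ∀ᵐ p ∂(P.prod ν), ‖φ (η p.1 + Measure.dirac p.2)‖ ≤ K :=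
    hη.ae_add_dirac (p := fun m => ‖φ m‖ ≤ K) (measurableSet_le hφ.norm measurable_const) hK
  exact ⟨memLp_top_of_bound
      (hφ.comp (hη.measurable.comp measurable_fst)).aestronglyMeasurable K h1,
    memLp_top_of_bound (hφ.comp hη.measurable_add_dirac).aestronglyMeasurable K h2⟩

/-- With $F_+=F(\eta+\delta_z)$ and likewise $\Phi_+$, it rests on
$F_+\Phi_+-F\Phi-\frac12(F_++F)(\Phi_+-\Phi)=\frac12(F_+-F)(\Phi_++\Phi)$, multiplied by $F_+-F$.
Boundedness makes both Dirichlet integrands integrable. -/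
theorem IsPoissonProcess.functionalGamma_eq (hη : IsPoissonProcess η ν P) {f φ : Measure Z → ℝ}
    (hf : f ∈ algebraA η ν P) (hφ : φ ∈ algebraA η ν P) :
    functionalGamma η ν P f φ = 1 / 2 * ∫ p, addOp f (η p.1) p.2 ^ 2 *
      (φ (η p.1) + φ (η p.1 + Measure.dirac p.2)) ∂(P.prod ν) := by
  obtain ⟨ha, ha'⟩ := hη.memLp_top_prod hf.1.1 hf.2
  obtain ⟨hb, hb'⟩ := hη.memLp_top_prod hφ.1.1 hφ.2
  have hDf := hη.memLp_addOp hf.1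
  have hDφ := hη.memLp_addOp hφ.1
  have h1 : MemLp (fun p : Ω × Z => addOp (fun m => f m * φ m) (η p.1) p.2) 2 (P.prod ν) := by
    have i1 : MemLp ((fun p : Ω × Z => f (η p.1 + Measure.dirac p.2)) *
      fun p => addOp φ (η p.1) p.2) 2 (P.prod ν) := hDφ.mul ha'
    have i2 : MemLp ((fun p : Ω × Z => φ (η p.1)) *
      fun p => addOp f (η p.1) p.2) 2 (P.prod ν) := hDf.mul hb
    refine (memLp_congr_ae (Eventually.of_forall fun p => ?_)).1 (i1.add i2)
    simp only [Pi.add_apply, Pi.mul_apply, addOp]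
    ring
  have h2 : MemLp (fun p : Ω × Z => addOp (fun m => f m ^ 2) (η p.1) p.2) 2 (P.prod ν) := by
    have i1 : MemLp (((fun p : Ω × Z => f (η p.1 + Measure.dirac p.2)) + fun p => f (η p.1)) *
      fun p => addOp f (η p.1) p.2) 2 (P.prod ν) := hDf.mul (ha'.add ha)
    refine (memLp_congr_ae (Eventually.of_forall fun p => ?_)).1 i1
    simp only [Pi.add_apply, Pi.mul_apply, addOp]
    ring
  have j1 : Integrable (fun p : Ω × Z => addOp f (η p.1) p.2 *
      addOp (fun m => f m * φ m) (η p.1) p.2) (P.prod ν) := hDf.integrable_mul h1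
  have j2 : Integrable (fun p : Ω × Z => addOp (fun m => f m ^ 2) (η p.1) p.2 *
      addOp φ (η p.1) p.2) (P.prod ν) := h2.integrable_mul hDφ
  rw [functionalGamma, dirichletForm, dirichletForm, ← integral_const_mul, ← integral_const_mul,
    ← integral_sub j1 (j2.const_mul _)]
  refine integral_congr_ae (Eventually.of_forall fun p => ?_)
  simp only [addOp]
  ring

theorem IsPoissonProcess.tendsto_functionalGamma (hη : IsPoissonProcess η ν P)
    {f φ : Measure Z → ℝ} (hf : f ∈ domD η ν P) (hφ : φ ∈ algebraA η ν P)
    {u : ℕ → Measure Z → ℝ} (hu : ApproximatesInDomD η ν P u f) :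
    Tendsto (fun n => functionalGamma η ν P (u n) φ) atTop
      (𝓝 (1 / 2 * ∫ p, addOp f (η p.1) p.2 ^ 2 *
        (φ (η p.1) + φ (η p.1 + Measure.dirac p.2)) ∂(P.prod ν))) := by
  obtain ⟨hA, -, hE⟩ := hu
  simp_rw [fun n => hη.functionalGamma_eq (hA n) hφ]
  refine Tendsto.const_mul _ ?_
  obtain ⟨hb, hb'⟩ := hη.memLp_top_prod hφ.1.1 hφ.2
  let w : Ω × Z → ℝ := fun p => φ (η p.1) + φ (η p.1 + Measure.dirac p.2)
  have hw : MemLp w ∞ (P.prod ν) := hb.add hb'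
  let v : Ω × Z → ℝ := fun p => addOp f (η p.1) p.2
  let d : ℕ → Ω × Z → ℝ := fun n p => addOp (u n) (η p.1) p.2 - v p
  have hv : MemLp v 2 (P.prod ν) := hη.memLp_addOp hf
  have hun : ∀ n, MemLp (fun p : Ω × Z => addOp (u n) (η p.1) p.2) 2 (P.prod ν) := fun n =>
    hη.memLp_addOp (hA n).1
  have hd : ∀ n, MemLp (d n) 2 (P.prod ν) := fun n => (hun n).sub hv
  have hsq : ∀ g : Ω × Z → ℝ, MemLp g 2 (P.prod ν) →
      Integrable (fun p => g p ^ 2 * w p) (P.prod ν) := fun g hg =>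
    hg.integrable_sq.mul_of_top_left hw
  have hd0 : Tendsto (fun n => eLpNorm (d n) 2 (P.prod ν)) atTop (𝓝 0) := by
    rw [tendsto_eLpNorm_two_iff]
    refine hE.congr fun n => ?_
    rw [hη.energy_eq ((hA n).1.1.fun_sub hf.1)]
    refine lintegral_congr fun p => ?_
    simp only [d, v, addOp]
    congr 2
    ring
  refine tendsto_integral_of_L1' _ (hsq v hv).1 (Eventually.of_forall fun n => hsq _ (hun n)) ?_
  set W := eLpNorm w ∞ (P.prod ν)
  set V := eLpNorm v 2 (P.prod ν)
  have hbound : ∀ n, eLpNorm ((fun p => addOp (u n) (η p.1) p.2 ^ 2 * w p) -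
      fun p => v p ^ 2 * w p) 1 (P.prod ν) ≤
      eLpNorm (d n) 2 (P.prod ν) * (W * (eLpNorm (d n) 2 (P.prod ν) + (V + V))) := fun n => by
    -- With `d n` the error in `D⁺`, the difference of squares is `d n * (d n + 2 v)`; Hölder is
    -- then applied with exponents (2, 2) and (∞, 2).
    have e : (fun p => addOp (u n) (η p.1) p.2 ^ 2 * w p) - (fun p => v p ^ 2 * w p) =
        d n • (w • (d n + (v + v))) := by
      funext p
      simp only [d, Pi.sub_apply, Pi.smul_apply', Pi.add_apply, Pi.mul_apply, smul_eq_mul]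
      ring
    rw [e]
    have hs : MemLp (d n + (v + v)) 2 (P.prod ν) := (hd n).add (hv.add hv)
    refine (eLpNorm_smul_le_mul_eLpNorm (p := 2) (q := 2)
      (hw.1.smul hs.1) (hd n).1).trans (mul_le_mul_right ?_ _)
    refine (eLpNorm_smul_le_mul_eLpNorm (p := ∞) (q := 2) hs.1 hw.1).trans (mul_le_mul_right ?_ _)
    exact (eLpNorm_add_le (hd n).1 (hv.add hv).1 (by norm_num)).trans
      (add_le_add le_rfl (eLpNorm_add_le hv.1 hv.1 (by norm_num)))
  refine tendsto_of_tendsto_of_tendsto_of_le_of_le tendsto_const_nhds ?_ (fun n => bot_le) hbound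
  have hlim : Tendsto (fun n => W * (eLpNorm (d n) 2 (P.prod ν) + (V + V))) atTop
      (𝓝 (W * (0 + (V + V)))) :=
    ENNReal.Tendsto.const_mul (hd0.add_const _) (Or.inr hw.2.ne)
  have hfin : W * (0 + (V + V)) ≠ ∞ :=
    ENNReal.mul_ne_top hw.2.ne (by simpa using hv.2.ne)
  have := ENNReal.Tendsto.mul hd0 (Or.inr hfin) hlim (Or.inr ENNReal.zero_ne_top)
  simpa using this

end Energy

/-! ### Density of bounded functionals -/

section Truncation

theorem abs_truncate_sub_le (c x y : ℝ) :
    |max (-c) (min c x) - max (-c) (min c y)| ≤ |x - y| :=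
  (abs_max_sub_max_le_max _ _ _ _).trans <| max_le (by simp) <|
    (abs_min_sub_min_le_max _ _ _ _).trans (by simp)

theorem truncate_of_abs_le {c x : ℝ} (h : |x| ≤ c) : max (-c) (min c x) = x := by
  obtain ⟨h1, h2⟩ := abs_le.1 h
  rw [min_eq_right h2, max_eq_right h1]

variable {η : Ω → Measure Z} {ν : Measure Z} {P : Measure Ω} [SigmaFinite ν]
  [IsProbabilityMeasure P]

/-- `𝓐` is dense in `dom D`. -/
theorem IsPoissonProcess.exists_approximatesInDomD (hη : IsPoissonProcess η ν P)
    {f : Measure Z → ℝ} (hf : f ∈ domD η ν P) : ∃ u, ApproximatesInDomD η ν P u f := by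
  -- Truncation at level `n` is 1-Lipschitz and fixes 0, so it increases neither `|f|` nor `|D⁺f|`.
  -- The errors are thus at most twice these, whence the majorants with factor 4.
  let T : ℕ → ℝ → ℝ := fun n x => max (-(n : ℝ)) (min n x)
  have hT0 : ∀ n, T n 0 = 0 := fun n => truncate_of_abs_le (by simp)
  have hTle : ∀ n x y, |T n x - T n y| ≤ |x - y| := fun n => abs_truncate_sub_le n
  have hTabs : ∀ n x, |T n x| ≤ |x| := fun n x => by simpa [hT0] using hTle n x 0
  have hTm : ∀ n, Measurable (T n) := fun n => by fun_prop
  have hTlim : ∀ x, Tendsto (fun n => T n x) atTop (𝓝 x) := fun x => by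
    refine tendsto_const_nhds.congr' ?_
    filter_upwards [eventually_ge_atTop ⌈|x|⌉₊] with n hn
    exact (truncate_of_abs_le (Nat.ceil_le.1 hn)).symm
  have hTbd : ∀ n x, |T n x| ≤ n := fun n x => by
    refine abs_le.2 ⟨le_max_left _ _, max_le ?_ (min_le_left _ _)⟩
    have : (0 : ℝ) ≤ n := n.cast_nonneg
    linarith
  have hfη : Measurable fun ω => f (η ω) := hf.1.comp hη.measurable
  have hDf := hη.measurable_addOp hf.1
  have hfin1 : ∫⁻ ω, ENNReal.ofReal (f (η ω) ^ 2) ∂P ≠ ∞ := by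
    have := hf.2.1.integrable_sq.lintegral_lt_top
    exact this.ne
  have hum : ∀ n, Measurable fun m => T n (f m) := fun n => (hTm n).comp hf.1
  refine ⟨fun n m => T n (f m), fun n => ⟨⟨hum n, ?_, ?_⟩, ?_⟩, ?_, ?_⟩
  · exact hf.2.1.of_le ((hTm n).comp hfη).aestronglyMeasurable
      (Eventually.of_forall fun ω => hTabs n _)
  · refine lt_of_le_of_lt ?_ hf.2.2
    refine lintegral_mono fun ω => lintegral_mono fun z => ENNReal.ofReal_le_ofReal ?_
    exact sq_le_sq.2 (hTle n _ _)
  · exact memLp_top_of_bound ((hTm n).comp hfη).aestronglyMeasurable n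
      (Eventually.of_forall fun ω => hTbd n _)
  · rw [tendsto_eLpNorm_two_iff]
    have key := tendsto_lintegral_of_dominated_convergence (μ := P)
      (F := fun n ω => ENNReal.ofReal ((T n (f (η ω)) - f (η ω)) ^ 2)) (f := fun _ => 0)
      (fun ω => ENNReal.ofReal (4 * f (η ω) ^ 2))
      (fun n => ((((hTm n).comp hfη).sub hfη).pow_const 2).ennreal_ofReal)
      (fun n => Eventually.of_forall fun ω => ?_) ?_ (Eventually.of_forall fun ω => ?_)
    · simpa using key
    · refine ENNReal.ofReal_le_ofReal ?_
      have : |T n (f (η ω)) - f (η ω)| ≤ |2 * f (η ω)| := by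
        rw [abs_mul, abs_two, two_mul]
        exact (abs_sub _ _).trans (add_le_add (hTabs n _) le_rfl)
      calc _ ≤ (2 * f (η ω)) ^ 2 := sq_le_sq.2 this
        _ = _ := by ring
    · simp_rw [ENNReal.ofReal_mul (show (0 : ℝ) ≤ 4 by norm_num)]
      rw [lintegral_const_mul _ (hfη.pow_const 2).ennreal_ofReal]
      exact ENNReal.mul_ne_top (by simp) hfin1
    · have := (((hTlim (f (η ω))).sub_const (f (η ω))).pow 2)
      simpa using ENNReal.tendsto_ofReal this
  · simp_rw [fun n => hη.energy_eq ((hum n).fun_sub hf.1)]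
    have hm : ∀ n, Measurable fun p : Ω × Z => addOp (fun m => T n (f m) - f m) (η p.1) p.2 :=
      fun n => hη.measurable_addOp ((hum n).fun_sub hf.1)
    have key := tendsto_lintegral_of_dominated_convergence (μ := P.prod ν)
      (F := fun n p => ENNReal.ofReal (addOp (fun m => T n (f m) - f m) (η p.1) p.2 ^ 2))
      (f := fun _ => 0)
      (fun p => ENNReal.ofReal (4 * addOp f (η p.1) p.2 ^ 2))
      (fun n => ((hm n).pow_const 2).ennreal_ofReal)
      (fun n => Eventually.of_forall fun p => ?_) ?_ (Eventually.of_forall fun p => ?_)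
    · simpa using key
    · refine ENNReal.ofReal_le_ofReal ?_
      have : |addOp (fun m => T n (f m) - f m) (η p.1) p.2| ≤ |2 * addOp f (η p.1) p.2| := by
        rw [abs_mul, abs_two, two_mul]
        refine le_trans (le_of_eq ?_) ((abs_sub _ _).trans (add_le_add
          (hTle n (f (η p.1 + Measure.dirac p.2)) (f (η p.1))) le_rfl))
        congr 1
        simp only [addOp]
        ring
      calc _ ≤ (2 * addOp f (η p.1) p.2) ^ 2 := sq_le_sq.2 this
        _ = _ := by ring
    · simp_rw [ENNReal.ofReal_mul (show (0 : ℝ) ≤ 4 by norm_num)]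
      rw [lintegral_const_mul _ (hDf.pow_const 2).ennreal_ofReal, ← hη.energy_eq hf.1]
      exact ENNReal.mul_ne_top (by simp) hf.2.2.ne
    · have h1 := fun m => ((hTlim (f m)).sub_const (f m))
      have := ((h1 (η p.1 + Measure.dirac p.2)).sub (h1 (η p.1))).pow 2
      simpa [addOp] using ENNReal.tendsto_ofReal this

end Truncation

/-! ### Cylinder indicators as test functionals -/

section Separation

variable {η : Ω → Measure Z} {ν : Measure Z} {P : Measure Ω} [IsProbabilityMeasure P]

/-- Adding a point outside the union `U` of the sets of `J` changes no count, so `(D⁺)²` is at most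
the indicator of `U` and the energy at most `ν U < ∞`. -/
theorem IsPoissonProcess.indicator_mem_algebraA (hη : IsPoissonProcess η ν P)
    (J : Finset (FiniteSets ν)) {S : Set (J → ℝ≥0∞)} (hS : MeasurableSet S) :
    {m : Measure Z | (fun b : J => m b.1.1) ∈ S}.indicator (fun _ => (1 : ℝ)) ∈
      algebraA η ν P := by
  set A := {m : Measure Z | (fun b : J => m b.1.1) ∈ S}
  have hA : MeasurableSet A :=
    (measurable_pi_iff.2 fun b : J => Measure.measurable_coe b.1.2.1) hS
  have hm : Measurable (A.indicator fun _ => (1 : ℝ)) := measurable_const.indicator hA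
  have hb : ∀ m, ‖A.indicator (fun _ => (1 : ℝ)) m‖ ≤ 1 := fun m => by
    by_cases h : m ∈ A <;> simp [h]
  have hmη : AEStronglyMeasurable (fun ω => A.indicator (fun _ => (1 : ℝ)) (η ω)) P :=
    (hm.comp hη.measurable).aestronglyMeasurable
  refine ⟨⟨hm, MemLp.of_bound hmη 1 (Eventually.of_forall fun ω => hb _), ?_⟩,
    memLp_top_of_bound hmη 1 (Eventually.of_forall fun ω => hb _)⟩
  let U : Set Z := ⋃ b : J, b.1.1
  have hU : MeasurableSet U := MeasurableSet.iUnion fun b => b.1.2.1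
  have hνU : ν U < ∞ := (measure_iUnion_fintype_le ν _).trans_lt
    (ENNReal.sum_lt_top.2 fun b _ => b.1.2.2)
  have hbd : ∀ m z, ENNReal.ofReal (addOp (A.indicator fun _ => (1 : ℝ)) m z ^ 2) ≤
      U.indicator 1 z := fun m z => by
    by_cases hz : z ∈ U
    · rw [Set.indicator_of_mem hz, Pi.one_apply, addOp]
      by_cases h1 : m + Measure.dirac z ∈ A <;> by_cases h2 : m ∈ A <;> simp [h1, h2]
    · have : m + Measure.dirac z ∈ A ↔ m ∈ A := by
        have hzz : ∀ b : J, (m + Measure.dirac z) b.1.1 = m b.1.1 := fun b => by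
          have hzb : z ∉ b.1.1 := fun h => hz (Set.mem_iUnion.2 ⟨b, h⟩)
          rw [Measure.add_apply, Measure.dirac_apply' _ b.1.2.1, Set.indicator_of_notMem hzb,
            add_zero]
        simp only [A, Set.mem_ofPred_eq, hzz]
      rw [Set.indicator_of_notMem hz, addOp]
      by_cases h2 : m ∈ A <;> simp [h2, this]
  calc energy η ν P (A.indicator fun _ => (1 : ℝ))
      ≤ ∫⁻ _, ∫⁻ z, U.indicator 1 z ∂ν ∂P :=
        lintegral_mono fun ω => lintegral_mono fun z => hbd _ z
    _ = ν U := by rw [lintegral_indicator_one hU]; simp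
    _ < ∞ := hνU

variable [SigmaFinite ν]

/-- `𝓐` separates the non-negative integrable functionals of the process. -/
theorem IsPoissonProcess.ae_eq_of_forall_algebraA (hη : IsPoissonProcess η ν P)
    {g h : Measure Z → ℝ} (hg : Measurable g) (hh : Measurable h)
    (hg0 : ∀ᵐ ω ∂P, 0 ≤ g (η ω)) (hh0 : ∀ᵐ ω ∂P, 0 ≤ h (η ω))
    (hgi : Integrable (fun ω => g (η ω)) P) (hhi : Integrable (fun ω => h (η ω)) P)
    (H : ∀ φ ∈ algebraA η ν P, ∫ ω, g (η ω) * φ (η ω) ∂P = ∫ ω, h (η ω) * φ (η ω) ∂P) :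
    ∀ᵐ ω ∂P, g (η ω) = h (η ω) := by
  have hfin : ∀ {k : Measure Z → ℝ}, Measurable k → Integrable (fun ω => k (η ω)) P →
      ∫⁻ m, ENNReal.ofReal (k m) ∂(P.map η) ≠ ∞ := fun {k} hk hki => by
    rw [lintegral_map hk.ennreal_ofReal hη.measurable]
    exact hki.lintegral_lt_top.ne
  have := isFiniteMeasure_withDensity (hfin hg hgi)
  have := isFiniteMeasure_withDensity (hfin hh hhi)
  -- Testing against cylinder indicators compares these two finite measures on cylinder events.
  have key : (P.map η).withDensity (fun m => ENNReal.ofReal (g m)) =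
      (P.map η).withDensity (fun m => ENNReal.ofReal (h m)) := by
    refine ext_of_counts ν fun J S hS => ?_
    have hφ := hη.indicator_mem_algebraA (P := P) J hS
    set A := {m : Measure Z | (fun b : J => m b.1.1) ∈ S}
    have hA : MeasurableSet A :=
      (measurable_pi_iff.2 fun b : J => Measure.measurable_coe b.1.2.1) hS
    have e : ∀ {k : Measure Z → ℝ}, Measurable k → (∀ᵐ ω ∂P, 0 ≤ k (η ω)) →
        Integrable (fun ω => k (η ω)) P →
        (P.map η).withDensity (fun m => ENNReal.ofReal (k m)) A =
          ENNReal.ofReal (∫ ω, k (η ω) * A.indicator (fun _ => (1 : ℝ)) (η ω) ∂P) := by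
      intro k hk hk0 hki
      have e1 : ∀ ω, k (η ω) * A.indicator (fun _ => (1 : ℝ)) (η ω) =
          (η ⁻¹' A).indicator (fun ω => k (η ω)) ω := fun ω => by
        by_cases hω : η ω ∈ A
        · rw [Set.indicator_of_mem hω, Set.indicator_of_mem (by exact hω), mul_one]
        · rw [Set.indicator_of_notMem hω, Set.indicator_of_notMem (by exact hω), mul_zero]
      simp_rw [e1]
      rw [integral_indicator (hη.measurable hA), ofReal_integral_eq_lintegral_ofReal
        hki.integrableOn (ae_restrict_of_ae hk0), withDensity_apply _ hA,
        setLIntegral_map hA hk.ennreal_ofReal hη.measurable]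
    rw [e hg hg0 hgi, e hh hh0 hhi, H _ hφ]
  rw [withDensity_eq_iff hg.ennreal_ofReal.aemeasurable hh.ennreal_ofReal.aemeasurable
    (hfin hg hgi)] at key
  filter_upwards [ae_of_ae_map hη.measurable.aemeasurable key, hg0, hh0] with ω h1 h2 h3
  exact (ENNReal.ofReal_eq_ofReal_iff h2 h3).1 h1

end Separation

/-! ### The density: existence, formula, uniqueness -/

section CarreDuChamp

/-- The carré du champ of `f`, where `r (m, z)` is a measurable version of `f (m - δ_z)`. -/
noncomputable def carreDuChamp (ν : Measure Z) [SigmaFinite ν] (f : Measure Z → ℝ)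
    (r : Measure Z × Z → ℝ) (m : Measure Z) : ℝ :=
  1 / 2 * ∫ z, addOp f m z ^ 2 ∂ν + 1 / 2 * ∫ z, (f m - r (m, z)) ^ 2 ∂(evalKernel ν m)

variable {η : Ω → Measure Z} {ν : Measure Z} {P : Measure Ω} {f : Measure Z → ℝ}

/-- The carré du champ depends only on the law of the functional. -/
theorem IsCarreDuChamp.congr {g h : Measure Z → ℝ} (hg : IsCarreDuChamp η ν P f g)
    (hh : Measurable h) (e : ∀ᵐ ω ∂P, h (η ω) = g (η ω)) : IsCarreDuChamp η ν P f h := by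
  refine ⟨hh, ?_, hg.2.2.1.congr (e.mono fun ω h => h.symm), fun φ hφ => ?_⟩
  · filter_upwards [hg.2.1, e] with ω h1 h2
    rwa [h2]
  · rw [integral_congr_ae (e.mono fun ω h => by simp only [h] :
      (fun ω => h (η ω) * φ (η ω)) =ᵐ[P] fun ω => g (η ω) * φ (η ω))]
    exact hg.2.2.2 φ hφ

variable [SigmaFinite ν] {r : Measure Z × Z → ℝ}

theorem measurable_carreDuChamp (hf : Measurable f) (hr : Measurable r) :
    Measurable (carreDuChamp ν f r) := by
  have h1 : StronglyMeasurable fun p : Measure Z × Z => addOp f p.1 p.2 ^ 2 :=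
    ((measurable_addOp hf).pow_const 2).stronglyMeasurable
  have h2 : StronglyMeasurable fun p : Measure Z × Z => (f p.1 - r p) ^ 2 :=
    (((hf.comp measurable_fst).sub hr).pow_const 2).stronglyMeasurable
  exact (h1.integral_prod_right.measurable.const_mul _).add
    (h2.integral_kernel_prod_right'.measurable.const_mul _)

theorem carreDuChamp_nonneg (m : Measure Z) : 0 ≤ carreDuChamp ν f r m := by
  have h1 : 0 ≤ ∫ z, addOp f m z ^ 2 ∂ν := integral_nonneg fun z => sq_nonneg _
  have h2 : 0 ≤ ∫ z, (f m - r (m, z)) ^ 2 ∂(evalKernel ν m) := integral_nonneg fun z => sq_nonneg _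
  unfold carreDuChamp
  positivity

variable [IsProbabilityMeasure P]

/-- Under the Mecke substitution `m = η + δ_z`, `r (m, z)` becomes `f(η)`, so the drop difference
turns into `D⁺_z F`. -/
theorem IsPoissonProcess.integrable_compProd (hη : IsPoissonProcess η ν P) (hf : f ∈ domD η ν P)
    (hr : Measurable r) (hrf : ∀ m z, r (m + Measure.dirac z, z) = f m)
    {φ : Measure Z → ℝ} (hφ : Measurable φ)
    (hφ' : MemLp (fun ω => φ (η ω)) ∞ P) :
    Integrable (fun p : Measure Z × Z => (f p.1 - r p) ^ 2 * φ p.1)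
      ((P.map η) ⊗ₘ (evalKernel ν)) ∧
    ∫ p : Measure Z × Z, (f p.1 - r p) ^ 2 * φ p.1 ∂((P.map η) ⊗ₘ (evalKernel ν)) =
      ∫ p, addOp f (η p.1) p.2 ^ 2 * φ (η p.1 + Measure.dirac p.2) ∂(P.prod ν) := by
  have hΦ : Measurable fun p : Ω × Z => (η p.1 + Measure.dirac p.2, p.2) :=
    hη.measurable_add_dirac.prodMk measurable_snd
  have hH : Measurable fun p : Measure Z × Z => (f p.1 - r p) ^ 2 * φ p.1 :=
    (((hf.1.comp measurable_fst).sub hr).pow_const 2).mul (hφ.comp measurable_fst)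
  have hi : Integrable (fun p : Ω × Z => addOp f (η p.1) p.2 ^ 2 *
      φ (η p.1 + Measure.dirac p.2)) (P.prod ν) :=
    (hη.memLp_addOp hf).integrable_sq.mul_of_top_left (hη.memLp_top_prod hφ hφ').2
  rw [hη.mecke, integrable_map_measure hH.aestronglyMeasurable hΦ.aemeasurable,
    integral_map hΦ.aemeasurable hH.aestronglyMeasurable]
  simp only [Function.comp_def, hrf]
  exact ⟨hi, rfl⟩

/-- It rules out the default value 0 of the Bochner integrals in `carreDuChamp`, which therefore
agree with the Lebesgue integrals of the final formula. -/
theorem IsPoissonProcess.ae_integrable (hη : IsPoissonProcess η ν P) (hf : f ∈ domD η ν P)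
    (hr : Measurable r) (hrf : ∀ m z, r (m + Measure.dirac z, z) = f m) :
    ∀ᵐ ω ∂P, Integrable (fun z => addOp f (η ω) z ^ 2) ν ∧
      Integrable (fun z => (f (η ω) - r (η ω, z)) ^ 2) (evalKernel ν (η ω)) := by
  have : IsProbabilityMeasure (P.map η) :=
    Measure.isProbabilityMeasure_map hη.measurable.aemeasurable
  obtain ⟨h1, -⟩ := hη.integrable_compProd hf hr hrf (φ := fun _ => 1) measurable_const
    (memLp_const 1)
  have h2 := ae_of_ae_map hη.measurable.aemeasurable
    ((Measure.integrable_compProd_iff h1.1).1 h1).1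
  filter_upwards [(hη.memLp_addOp hf).integrable_sq.prod_right_ae, h2] with ω h3 h4
  exact ⟨h3, by simpa using h4⟩

theorem IsPoissonProcess.integral_carreDuChamp_mul (hη : IsPoissonProcess η ν P)
    (hf : f ∈ domD η ν P)
    (hr : Measurable r) (hrf : ∀ m z, r (m + Measure.dirac z, z) = f m)
    {φ : Measure Z → ℝ} (hφ : Measurable φ)
    (hφ' : MemLp (fun ω => φ (η ω)) ∞ P) :
    Integrable (fun ω => carreDuChamp ν f r (η ω) * φ (η ω)) P ∧
    ∫ ω, carreDuChamp ν f r (η ω) * φ (η ω) ∂P =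
      1 / 2 * ∫ p, addOp f (η p.1) p.2 ^ 2 *
        (φ (η p.1) + φ (η p.1 + Measure.dirac p.2)) ∂(P.prod ν) := by
  have : IsProbabilityMeasure (P.map η) :=
    Measure.isProbabilityMeasure_map hη.measurable.aemeasurable
  obtain ⟨hb, hb'⟩ := hη.memLp_top_prod hφ hφ'
  have hsq := (hη.memLp_addOp hf).integrable_sq
  have i1 : Integrable (fun p : Ω × Z => addOp f (η p.1) p.2 ^ 2 * φ (η p.1)) (P.prod ν) :=
    hsq.mul_of_top_left hb
  have i2 : Integrable (fun p : Ω × Z => addOp f (η p.1) p.2 ^ 2 *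
      φ (η p.1 + Measure.dirac p.2)) (P.prod ν) := hsq.mul_of_top_left hb'
  obtain ⟨i3, e3⟩ := hη.integrable_compProd hf hr hrf hφ hφ'
  have j1 := i1.integral_prod_left
  have e1 := integral_prod _ i1
  -- The law of `η` is regarded as a constant kernel on `Unit` to integrate out `z`.
  have i4 : Integrable (fun m => ∫ z, (f m - r (m, z)) ^ 2 * φ m ∂(evalKernel ν m)) (P.map η) :=
    Integrable.integral_compProd (κ := Kernel.const Unit (P.map η))
      (η := Kernel.prodMkLeft Unit (evalKernel ν)) (a := ()) i3
  have j3 := (integrable_map_measure i4.1 hη.measurable.aemeasurable).1 i4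
  have e4 := Measure.integral_compProd i3
  rw [integral_map hη.measurable.aemeasurable i4.1] at e4
  simp only [Function.comp_def, integral_mul_const] at j1 e1 j3 e4
  have hsplit : ∀ ω, carreDuChamp ν f r (η ω) * φ (η ω) =
      1 / 2 * ((∫ z, addOp f (η ω) z ^ 2 ∂ν) * φ (η ω)) +
      1 / 2 * ((∫ z, (f (η ω) - r (η ω, z)) ^ 2 ∂(evalKernel ν (η ω))) * φ (η ω)) := fun ω => by
    rw [carreDuChamp]; ring
  simp_rw [hsplit]
  refine ⟨(j1.const_mul _).add (j3.const_mul _), ?_⟩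
  rw [integral_add (j1.const_mul _) (j3.const_mul _), integral_const_mul, integral_const_mul,
    ← e1, ← e4, e3, ← mul_add, ← integral_add i1 i2]
  simp_rw [mul_add]

theorem IsPoissonProcess.isCarreDuChamp (hη : IsPoissonProcess η ν P) (hf : f ∈ domD η ν P)
    (hr : Measurable r) (hrf : ∀ m z, r (m + Measure.dirac z, z) = f m) :
    IsCarreDuChamp η ν P f (carreDuChamp ν f r) := by
  refine ⟨measurable_carreDuChamp hf.1 hr, Eventually.of_forall fun ω => carreDuChamp_nonneg _, ?_,
    fun φ hφ => ⟨hη.exists_approximatesInDomD hf, fun u hu => ?_⟩⟩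
  · simpa using (hη.integral_carreDuChamp_mul hf hr hrf (φ := fun _ => 1) measurable_const
      (memLp_const 1)).1
  · rw [(hη.integral_carreDuChamp_mul hf hr hrf hφ.1.1 hφ.2).2]
    exact hη.tendsto_functionalGamma hf hφ hu

theorem IsPoissonProcess.ofReal_carreDuChamp (hη : IsPoissonProcess η ν P) (hf : f ∈ domD η ν P)
    (hr : Measurable r) (hrf : ∀ m z, r (m + Measure.dirac z, z) = f m)
    (hproper : ∀ᵐ ω ∂P, IsProper (η ω)) :
    ∀ᵐ ω ∂P, ENNReal.ofReal (carreDuChamp ν f r (η ω)) =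
      (1 / 2) * ∫⁻ z, ENNReal.ofReal (addOp f (η ω) z ^ 2) ∂ν +
      (1 / 2) * upperIntegral (η ω) (fun z => ENNReal.ofReal (dropOp f (η ω) z ^ 2)) := by
  filter_upwards [hproper, hη.ae_evalKernel_eq, hη.ae_integrable hf hr hrf] with ω h1 h2 ⟨h3, h4⟩
  have half : ENNReal.ofReal (1 / 2) = 1 / 2 := by
    rw [ENNReal.ofReal_div_of_pos (by norm_num)]; simp
  have n1 : 0 ≤ ∫ z, addOp f (η ω) z ^ 2 ∂ν := integral_nonneg fun z => sq_nonneg _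
  have n2 : 0 ≤ ∫ z, (f (η ω) - r (η ω, z)) ^ 2 ∂(evalKernel ν (η ω)) :=
    integral_nonneg fun z => sq_nonneg _
  rw [carreDuChamp, ENNReal.ofReal_add (by positivity) (by positivity),
    ENNReal.ofReal_mul (by norm_num), ENNReal.ofReal_mul (by norm_num), half,
    ofReal_integral_eq_lintegral_ofReal h3 (Eventually.of_forall fun z => sq_nonneg _),
    ofReal_integral_eq_lintegral_ofReal h4 (Eventually.of_forall fun z => sq_nonneg _), h2,
    h1.upperIntegral_dropOp_sq hr hrf]

/-- Along one approximating sequence both pairings with `φ` are limits of the same numbers, and `𝓐`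
separates. -/
theorem IsCarreDuChamp.ae_unique (hη : IsPoissonProcess η ν P) {g h : Measure Z → ℝ}
    (hg : IsCarreDuChamp η ν P f g) (hh : IsCarreDuChamp η ν P f h) :
    ∀ᵐ ω ∂P, g (η ω) = h (η ω) := by
  refine hη.ae_eq_of_forall_algebraA hg.1 hh.1 hg.2.1 hh.2.1 hg.2.2.1 hh.2.2.1 fun φ hφ => ?_
  obtain ⟨⟨u, hu⟩, h1⟩ := hg.2.2.2 φ hφ
  exact tendsto_nhds_unique (h1 u hu) ((hh.2.2.2 φ hφ).2 u hu)

end CarreDuChamp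

end PoissonSpace

theorem mainTheorem11 {Z Ω : Type*} [MeasurableSpace Z] [MeasurableSpace Ω]
    (ν : Measure Z) [SigmaFinite ν] (P : Measure Ω) [IsProbabilityMeasure P]
    (η : Ω → Measure Z) (hη : PoissonSpace.IsPoissonProcess η ν P)
    (hproper : ∀ᵐ ω ∂P, PoissonSpace.IsProper (η ω)) :
    PoissonSpace.domGamma η ν P = PoissonSpace.domD η ν P ∧
    ∀ f ∈ PoissonSpace.domD η ν P, ∀ g : Measure Z → ℝ, Measurable g →
      (PoissonSpace.IsCarreDuChamp η ν P f g ↔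
        (∀ᵐ ω ∂P, 0 ≤ g (η ω)) ∧
        ∀ᵐ ω ∂P, ENNReal.ofReal (g (η ω)) =
          (1 / 2) * ∫⁻ z, ENNReal.ofReal (PoissonSpace.addOp f (η ω) z ^ 2) ∂ν +
          (1 / 2) * PoissonSpace.upperIntegral (η ω)
            (fun z => ENNReal.ofReal (PoissonSpace.dropOp f (η ω) z ^ 2))) := by
  refine ⟨Set.Subset.antisymm (fun f hf => hf.1) fun f hf => ?_, fun f hf g hg => ?_⟩
  · obtain ⟨r, hr, hrf⟩ := PoissonSpace.exists_removal ν hf.1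
    exact ⟨hf, _, hη.isCarreDuChamp hf hr hrf⟩
  · obtain ⟨r, hr, hrf⟩ := PoissonSpace.exists_removal ν hf.1
    have hc := hη.isCarreDuChamp hf hr hrf
    have hformula := hη.ofReal_carreDuChamp hf hr hrf hproper
    constructor
    · intro h
      refine ⟨h.2.1, ?_⟩
      filter_upwards [h.ae_unique hη hc, hformula] with ω h1 h2
      rw [h1, h2]
    · rintro ⟨h0, h1⟩
      refine hc.congr hg ?_
      filter_upwards [h0, h1, hformula] with ω h2 h3 h4
      -- `ENNReal.ofReal` is injective only on non-negative reals; hence the sign condition on `g`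
      -- beside the formula.
      exact (ENNReal.ofReal_eq_ofReal_iff h2 (PoissonSpace.carreDuChamp_nonneg _)).1
        (h3.trans h4.symm)
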